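/- Let $G=(V,E)$ be a known finite directed graph with $n=|V|$, $m=|E|$, and for each node $v$ let $r_v\in(0,1]$ be a known retention rate; write $\bar r=\frac1n\sum_{v}\frac1{r_v^2}$. Let $\lambda\in(0,0.5)$, and consider either of the following diffusion models with one parameter $w_e$ per edge $e$. * DIC (discrete-time independent cascade), with $w_e\in[\lambda,1-\lambda]$ for all $e\in E$: the seeds are active at time $0$; a node $u$ that becomes active in step $t$ makes, in step $t+1$, one attempt to activate each currently inactive out-neighbour $v$, which succeeds independently with probability $w_{uv}$. * DLT (discrete-time linear threshold), with $w_e\in[\lambda,1-\lambda]$ for all $e\in E$ and $1-\sum_{u\in N(v)}w_{uv}\in[\lambda,1-\lambda]$ for all $v\in V$, where $N(v)$ is the set of in-neighbours of $v$: each node $v$ draws an independent threshold $\theta_v$ uniform on $[0,1]$, and becomes active at step $t$ if the total weight of the edges from nodes active at step $t-1$ into $v$ is at least $\theta_v$. Active nodes remain active. Let $\Delta_S$ be the distribution of the final active set for the seed set $S$, and let $F(S)=(\Pr_{A\sim\Delta_S}[v\in A])_{v\in V}$ be the influence function. For a distribution $\mathcal P$ on seed sets, let $\mathrm{err}[F]=\mathbb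 E_{S\sim\mathcal P,\,A\sim\Delta_S}\frac1n\|\mathbf 1_A-F(S)\|_2^2$, where $\Delta_S$ is the true model. An incomplete cascade is a pair $(S,\tilde A)$, where $S\sim\mathcal P$, $A\sim\Delta_S$, and $\tilde A$ consists of $S$ and of each $v\in A\setminus S$ independently with probability $r_v$. Then for each of the two models the class of influence functions with the stated parameter constraints is properly PAC learnable with sample complexity $\tilde O\big(\bar r^2n^3m/\varepsilon^2\big)$. That is, there are universal constants $C>0$ and $k\in\mathbb N$ such that for all $G$, $(r_v)$ and $\lambda$ as above there is a learning algorithm which, given $M$ incomplete cascades, outputs an influence function of the class (if the class is non-empty), with the following property. For all $\varepsilon,\delta\in(0,1)$, all true parameters satisfying the constraints, with influence function $F^*$, all distributions $\mathcal P$ on seed sets, and all $$M\ \ge\ C\,\frac{\bar r^2n^3m}{\varepsilon^2}\Big(1+\log\frac{nm\bar r}{\varepsilon\delta}\Big)^k,$$ the output $F$ on $M$ independent incomplete cascades satisfies $\Pr\big[\mathrm{err}[F]-\mathrm{err}[F^*]\ge\varepsilon\big]\le\delta$. (For $m=0$ the right-hand side of the bound on $M$ is read as $0$.) -/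

import Mathlib

open MeasureTheory

noncomputable section

namespace Diffusion

universe u

/-! ## Randomness -/

/-- Independent coins: coin `i` shows `true` with probability `p i`. -/
def coinFlips {ι : Type u} [Fintype ι] (p : ι → unitInterval) : PMF (ι → Bool) :=
  haveI : ∀ i, IsProbabilityMeasure (ProbabilityTheory.bernoulliMeasure true false (p i)) :=
    fun _ => inferInstance
  (Measure.pi fun i => ProbabilityTheory.bernoulliMeasure true false (p i)).toPMF

variable {V : Type u} [Fintype V] [DecidableEq V]

/-! ## Diffusion models on the directed graph with node set `V` and edge set `E`

A model with fixed parameters is given by the map sending each seed set `S` to the distribution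
of the final active set. -/

/-- The nodes outside `A` that are successfully activated by a newly active node, i.e. a node of
`N`, when the success of the attempt along each edge is recorded by `X`. -/
def newlyActivated (E : Finset (V × V)) (A N : Finset V) (X : E → Bool) : Finset V :=
  {v : V | v ∉ A ∧ ∃ e : E, e.1.1 ∈ N ∧ e.1.2 = v ∧ X e = true}

/-- One step of the discrete-time independent cascade. A state is a pair consisting of the set of
active nodes and the set of nodes that became active in the most recent step. Each newly active
node `u` makes one attempt on each inactive out-neighbour `v`, which succeeds with probability
`w (u, v)`, independently of everything else. -/
def dicStep (E : Finset (V × V)) (w : E → unitInterval) (s : Finset V × Finset V) :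
    PMF (Finset V × Finset V) :=
  (coinFlips w).map fun X => (s.1 ∪ newlyActivated E s.1 s.2 X, newlyActivated E s.1 s.2 X)

/-- The law of the state of the independent cascade after `t` steps, with seed set `S`. -/
def dicState (E : Finset (V × V)) (w : E → unitInterval) (S : Finset V) :
    ℕ → PMF (Finset V × Finset V)
  | 0 => PMF.pure (S, S)
  | t + 1 => (dicState E w S t).bind (dicStep E w)

/-- The discrete-time independent cascade (DIC) model: the distribution of the final active set.
A step without new activations is followed by no further activation, hence the process has
stopped after `|V|` steps. -/
def dic (E : Finset (V × V)) (w : E → unitInterval) (S : Finset V) : PMF (Finset V) :=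
  (dicState E w S (Fintype.card V)).map Prod.fst

/-- Total weight of the edges from nodes of `A` into `v`. -/
def inWeight (E : Finset (V × V)) (w : E → ℝ) (A : Finset V) (v : V) : ℝ :=
  ∑ e : E with e.1.1 ∈ A ∧ e.1.2 = v, w e

/-- The active set of the linear threshold process after `t` steps, with seed set `S` and
thresholds `θ`. -/
def dltActive (E : Finset (V × V)) (w : E → ℝ) (S : Finset V) (θ : V → unitInterval) :
    ℕ → Finset V
  | 0 => S
  | t + 1 => dltActive E w S θ t ∪
      ({v : V | (θ v : ℝ) ≤ inWeight E w (dltActive E w S θ t) v} : Finset V)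

lemma measurable_dltActive (E : Finset (V × V)) (w : E → ℝ) (S : Finset V) (t : ℕ) :
    Measurable fun θ : V → unitInterval => dltActive E w S θ t := by
  induction t with
  | zero => exact measurable_const
  | succ t ih =>
    have h : Measurable fun θ : V → unitInterval => (θ, dltActive E w S θ t) :=
      measurable_id.prodMk ih
    have g : Measurable fun q : (V → unitInterval) × Finset V =>
        q.2 ∪ ({v : V | (q.1 v : ℝ) ≤ inWeight E w q.2 v} : Finset V) := by
      refine measurable_from_prod_countable_left fun A => ?_
      rw [measurable_finset_iff]
      intro a
      simp only [Finset.mem_union, Finset.mem_filter, Finset.mem_univ, true_and]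
      refine Measurable.or measurable_const ?_
      refine measurableSet_setOfPred.1 ?_
      exact measurableSet_le (by fun_prop) measurable_const
    exact g.comp h

/-- The discrete-time linear threshold (DLT) model: the distribution of the final active set when
the thresholds are independent and uniform on `[0, 1]`. A step without new activations is followed
by no further activation, hence the process has stopped after `|V|` steps. -/
def dlt (E : Finset (V × V)) (w : E → ℝ) (S : Finset V) : PMF (Finset V) :=
  haveI : IsProbabilityMeasure ((Measure.pi fun _ : V => (volume : Measure unitInterval)).map
      fun θ => dltActive E w S θ (Fintype.card V)) :=
    Measure.isProbabilityMeasure_map (measurable_dltActive E w S _).aemeasurable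
  ((Measure.pi fun _ : V => (volume : Measure unitInterval)).map
      fun θ => dltActive E w S θ (Fintype.card V)).toPMF

/-! ## Influence functions, cascades, error -/

/-- The influence function of a model: the marginal activation probabilities for each seed set. -/
def influence (D : Finset V → PMF (Finset V)) (S : Finset V) (v : V) : ℝ :=
  (D S).toMeasure.real {A | v ∈ A}

/-- The law of a complete cascade `(S, A)`, for seed sets drawn from `P`. -/
def cascade (P : PMF (Finset V)) (D : Finset V → PMF (Finset V)) : PMF (Finset V × Finset V) :=
  P.bind fun S => (D S).map fun A => (S, A)

/-- Incomplete observation of a complete cascade `(S, A)`: seeds are always observed, and each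
`v ∈ A \ S` is observed independently with probability `r v`. -/
def observe (r : V → unitInterval) (c : Finset V × Finset V) : PMF (Finset V × Finset V) :=
  (coinFlips r).map fun R => (c.1, c.1 ∪ {v ∈ c.2 \ c.1 | R v = true})

/-- The law of an incomplete cascade. -/
def incompleteCascade (r : V → unitInterval) (P : PMF (Finset V))
    (D : Finset V → PMF (Finset V)) : PMF (Finset V × Finset V) :=
  (cascade P D).bind (observe r)

/-- The law of `M` independent incomplete cascades. -/
def trainingLaw (r : V → unitInterval) (P : PMF (Finset V)) (D : Finset V → PMF (Finset V))
    (M : ℕ) : Measure (Fin M → Finset V × Finset V) :=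
  Measure.pi fun _ => (incompleteCascade r P D).toMeasure

/-- Quadratic loss `(1/n) ‖1_A - x‖²` of a vector `x` against a set `A`. -/
def sqLoss (A : Finset V) (x : V → ℝ) : ℝ :=
  1 / (Fintype.card V : ℝ) * ∑ v, ((if v ∈ A then 1 else 0) - x v) ^ 2

/-- Squared error of `F` with respect to the model `D`: the expectation of the quadratic loss over
the seed set and the (complete) diffusion process. -/
def sqErr (P : PMF (Finset V)) (D : Finset V → PMF (Finset V)) (F : Finset V → V → ℝ) : ℝ :=
  ∫ c, sqLoss c.2 (F c.1) ∂(cascade P D).toMeasure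

/-! ## Learnability -/

/-- The influence functions of the models `D θ`, for `θ` in the parameter set `W`, are properly PAC
learnable from incomplete cascades with known retention rates `r`, and `bound ε δ` training
cascades suffice: there is a learning algorithm that, knowing neither `ε`, `δ` nor the seed
distribution, always outputs a member of the class, and whose output has excess error at least `ε`
with probability at most `δ`. -/
def ProperlyPACLearnable {Θ : Type u} (D : Θ → Finset V → PMF (Finset V)) (W : Set Θ)
    (r : V → unitInterval) (bound : ℝ → ℝ → ℝ) : Prop :=
  ∃ alg : (M : ℕ) → (Fin M → Finset V × Finset V) → (Finset V → V → ℝ),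
    (W.Nonempty → ∀ M c, ∃ θ ∈ W, alg M c = influence (D θ)) ∧
    ∀ ε ∈ Set.Ioo (0 : ℝ) 1, ∀ δ ∈ Set.Ioo (0 : ℝ) 1, ∀ θ ∈ W, ∀ P : PMF (Finset V), ∀ M : ℕ,
      bound ε δ ≤ M →
        (trainingLaw r P (D θ) M).real
          {c | ε ≤ sqErr P (D θ) (alg M c) - sqErr P (D θ) (influence (D θ))} ≤ δ

/-- DIC parameters with all activation probabilities in `[lam, 1 - lam]`. -/
def dicParams (E : Finset (V × V)) (lam : ℝ) : Set (E → unitInterval) :=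
  {w | ∀ e, (w e : ℝ) ∈ Set.Icc lam (1 - lam)}

/-- DLT parameters with all edge weights, and for every node `v` also the difference of `1` and the
total weight into `v`, in `[lam, 1 - lam]`. -/
def dltParams (E : Finset (V × V)) (lam : ℝ) : Set (E → ℝ) :=
  {w | (∀ e, w e ∈ Set.Icc lam (1 - lam)) ∧
    ∀ v, 1 - inWeight E w Finset.univ v ∈ Set.Icc lam (1 - lam)}

/-- The average `r̄ = (1/n) ∑ v, 1 / (r v)²`. -/
def rbar (r : V → unitInterval) : ℝ :=
  1 / (Fintype.card V : ℝ) * ∑ v, 1 / (r v : ℝ) ^ 2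

/-- The quantity `C · (r̄² n³ m / ε²) · (1 + log (n m r̄ / (ε δ)))ᵏ`. -/
def sampleBound (E : Finset (V × V)) (r : V → unitInterval) (C : ℝ) (k : ℕ) (ε δ : ℝ) : ℝ :=
  C * (rbar r ^ 2 * (Fintype.card V : ℝ) ^ 3 * (E.card : ℝ) / ε ^ 2) *
    (1 + Real.log ((Fintype.card V : ℝ) * (E.card : ℝ) * rbar r / (ε * δ))) ^ k

end Diffusion

end

noncomputable section

namespace Diffusion

universe u

variable {V : Type u} [Fintype V] [DecidableEq V]

/-! ## Expectations over finite distributions -/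

section PMF

variable {α β : Type*} [Fintype α] [Fintype β] [MeasurableSpace α] [MeasurableSpace β]
  [MeasurableSingletonClass α] [MeasurableSingletonClass β]

/-! The learner minimizes an empirical risk that can be computed from incomplete cascades. Since an
indicator is idempotent, `(1_A(v) - x)² = 1_A(v)(1 - 2x) + x²` is affine in `1_A(v)`, so replacing
`1_A(v)` by `1_Ã(v) / r v` gives an unbiased estimate of the loss (`integral_lossEst`). The estimate
is bounded by `2 r̄` and is `4 r̄`-Lipschitz in the influence values.

Influence is Lipschitz in the edge parameters, by coupling: two parameter vectors are run on the
same uniform variables, and the runs differ only if some variable falls between two nearby bounds.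
The constant obtained is `n` for DIC (one coupling per time step) and `2ⁿ` for DLT (a union bound
over all possible active sets). An exponential constant is affordable: cutting the parameter cube
into cells of side about `ε / (r̄ 2ⁿ m)` gives a class whose log-cardinality is of order `m (n + log
(r̄ m / ε))`.

Hoeffding's inequality and a union bound over the cells then yield
`properlyPACLearnable_of_lipschitz`, from which both models follow. -/

lemma integral_bind (p : PMF α) (g : α → PMF β) (f : β → ℝ) :
    ∫ b, f b ∂(p.bind g).toMeasure = ∫ a, ∫ b, f b ∂(g a).toMeasure ∂p.toMeasure := by
  simp only [PMF.integral_eq_sum, smul_eq_mul, PMF.bind_apply, tsum_fintype, Finset.mul_sum]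
  rw [Finset.sum_comm]
  refine Finset.sum_congr rfl fun b _ => ?_
  rw [ENNReal.toReal_sum fun a _ => ENNReal.mul_ne_top (p.apply_ne_top a) ((g a).apply_ne_top b),
    Finset.sum_mul]
  exact Finset.sum_congr rfl fun a _ => by rw [ENNReal.toReal_mul, mul_assoc]

lemma integral_map (p : PMF α) (g : α → β) (f : β → ℝ) :
    ∫ b, f b ∂(p.map g).toMeasure = ∫ a, f (g a) ∂p.toMeasure := by
  have hg : Measurable g := measurable_of_finite g
  rw [← PMF.toMeasure_map g p hg]
  exact MeasureTheory.integral_map hg.aemeasurable .of_discrete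

lemma integral_congr_support (p : PMF α) {f g : α → ℝ} (h : ∀ a ∈ p.support, f a = g a) :
    ∫ a, f a ∂p.toMeasure = ∫ a, g a ∂p.toMeasure := by
  simp only [PMF.integral_eq_sum, smul_eq_mul]
  refine Finset.sum_congr rfl fun a _ => ?_
  by_cases ha : a ∈ p.support
  · rw [h a ha]
  · simp [(PMF.apply_eq_zero_iff p a).2 ha]

/-- Hoeffding's inequality for the lower tail of an average over independent samples. -/
lemma pi_real_sum_sub_ge_le (p : PMF α) (f : α → ℝ) {b t : ℝ} (hf : ∀ a, |f a| ≤ b) (ht : 0 ≤ t)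
    (M : ℕ) :
    (Measure.pi fun _ : Fin M => p.toMeasure).real
        {c | M * t ≤ ∑ i, (∫ a, f a ∂p.toMeasure - f (c i))}
      ≤ Real.exp (-(M * t ^ 2 / (2 * b ^ 2))) := by
  have hsub : ProbabilityTheory.HasSubgaussianMGF
      (fun a => ∫ a, f a ∂p.toMeasure - f a) ((‖b - -b‖₊ / 2) ^ 2) p.toMeasure := by
    have h := (ProbabilityTheory.hasSubgaussianMGF_of_mem_Icc (μ := p.toMeasure) (X := f)
      (a := -b) (b := b) .of_discrete (ae_of_all _ fun a => abs_le.1 (hf a))).neg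
    refine h.congr (ae_of_all _ fun a => ?_)
    simp
  have hind : ProbabilityTheory.iIndepFun
      (fun (i : Fin M) c => ∫ a, f a ∂p.toMeasure - f (c i))
      (Measure.pi fun _ : Fin M => p.toMeasure) :=
    ProbabilityTheory.iIndepFun_pi (X := fun _ a => ∫ a, f a ∂p.toMeasure - f a)
      fun _ => .of_discrete
  have hsub' : ∀ i ∈ Finset.univ, ProbabilityTheory.HasSubgaussianMGF
      (fun c : Fin M → α => ∫ a, f a ∂p.toMeasure - f (c i)) ((‖b - -b‖₊ / 2) ^ 2)
      (Measure.pi fun _ : Fin M => p.toMeasure) := by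
    intro i _
    refine ProbabilityTheory.HasSubgaussianMGF.of_map (Y := fun c : Fin M → α => c i)
      (X := fun a => ∫ a, f a ∂p.toMeasure - f a) (measurable_pi_apply i).aemeasurable ?_
    rwa [(measurePreserving_eval (fun _ : Fin M => p.toMeasure) i).map_eq]
  refine (ProbabilityTheory.HasSubgaussianMGF.measure_sum_ge_le_of_iIndepFun hind hsub'
    (by positivity : (0 : ℝ) ≤ M * t)).trans_eq ?_
  congr 1
  have hb : ((‖b - -b‖ / 2) ^ 2 : ℝ) = b ^ 2 := by
    rw [div_pow, Real.norm_eq_abs, sq_abs]; ring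
  simp only [Finset.sum_const, Finset.card_univ, Fintype.card_fin, nsmul_eq_mul, NNReal.coe_mul,
    NNReal.coe_natCast, NNReal.coe_pow, NNReal.coe_div, coe_nnnorm, NNReal.coe_ofNat, hb]
  -- If `M = 0` or `b = 0`, both exponents are `0`, the latter because division by zero gives `0`.
  rcases eq_or_ne (M : ℝ) 0 with hM | hM
  · simp [hM]
  rcases eq_or_ne b 0 with rfl | hb0
  · simp
  field_simp

end PMF

lemma toMeasure_coinFlips {ι : Type u} [Fintype ι] (p : ι → unitInterval) :
    (coinFlips p).toMeasure =
      Measure.pi fun i => ProbabilityTheory.bernoulliMeasure true false (p i) :=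
  Measure.toPMF_toMeasure _

lemma integral_coinFlips_ite {ι : Type u} [Fintype ι] (p : ι → unitInterval) (i : ι) (a : ℝ) :
    ∫ R, (if R i = true then a else 0) ∂(coinFlips p).toMeasure = p i * a := by
  classical
  rw [toMeasure_coinFlips]
  have h := (measurePreserving_eval
    (fun i => ProbabilityTheory.bernoulliMeasure true false (p i)) i)
  have h2 := MeasureTheory.integral_map (μ := Measure.pi fun i =>
    ProbabilityTheory.bernoulliMeasure true false (p i)) h.measurable.aemeasurable
    (f := fun b : Bool => if b = true then a else 0) .of_discrete
  rw [h.map_eq] at h2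
  refine h2.symm.trans ?_
  rw [ProbabilityTheory.integral_bernoulliMeasure]
  simp

/-! ## An unbiased estimate of the squared error from an incomplete cascade -/

/-- The estimate of the quadratic loss of `F` from an incomplete cascade: seeds contribute nothing,
and activations are reweighted by the inverse retention rates. -/
def lossEst (r : V → unitInterval) (F : Finset V → V → ℝ) (c : Finset V × Finset V) : ℝ :=
  1 / (Fintype.card V : ℝ) * ∑ v, if v ∈ c.1 then 0 else
    (if v ∈ c.2 then 1 / (r v : ℝ) else 0) * (1 - 2 * F c.1 v) + F c.1 v ^ 2

lemma influence_mem_Icc (D : Finset V → PMF (Finset V)) (S : Finset V) (v : V) :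
    influence D S v ∈ Set.Icc (0 : ℝ) 1 :=
  ⟨measureReal_nonneg, measureReal_le_one⟩

lemma influence_eq_integral (D : Finset V → PMF (Finset V)) (S : Finset V) (v : V) :
    influence D S v = ∫ A, (if v ∈ A then 1 else 0) ∂(D S).toMeasure := by
  rw [influence, ← integral_indicator_one (.of_discrete)]
  exact integral_congr_ae (ae_of_all _ fun A => by simp [Set.indicator])

lemma influence_eq_one {D : Finset V → PMF (Finset V)}
    (hD : ∀ S, ∀ A ∈ (D S).support, S ⊆ A) {S : Finset V} {v : V} (hv : v ∈ S) :
    influence D S v = 1 := by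
  rw [influence_eq_integral, integral_congr_support (D S) (g := fun _ => 1)]
  · simp
  · intro A hA
    simp [hD S A hA hv]

/-- At a non-seed, the reweighted observation has mean `1_A(v)` and the loss is affine in `1_A(v)`.
At a seed, `v ∈ A` and `F S v = 1`, so the true loss vanishes like its estimate. -/
lemma integral_lossEst_observe (r : V → unitInterval) (hr : ∀ v, 0 < r v)
    (F : Finset V → V → ℝ) {S A : Finset V} (hSA : S ⊆ A) (hF : ∀ v ∈ S, F S v = 1) :
    ∫ c, lossEst r F c ∂(observe r (S, A)).toMeasure = sqLoss A (F S) := by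
  rw [observe, integral_map]
  simp only [lossEst, sqLoss]
  rw [integral_const_mul, integral_finsetSum _ fun _ _ => .of_finite]
  congr 1
  refine Finset.sum_congr rfl fun v _ => ?_
  by_cases hv : v ∈ S
  · simp [hv, hSA hv, hF v hv]
  have hrv : (r v : ℝ) ≠ 0 := (unitInterval.coe_pos.2 (hr v)).ne'
  by_cases hA : v ∈ A
  · simp only [hv, hA, Finset.mem_union, Finset.mem_filter, Finset.mem_sdiff, if_false, if_true,
      false_or, not_false_eq_true, true_and]
    rw [integral_add .of_finite .of_finite, integral_mul_const, integral_coinFlips_ite]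
    simp [hrv]
    ring
  · simp [hv, hA]

lemma integral_lossEst (r : V → unitInterval) (hr : ∀ v, 0 < r v) (P : PMF (Finset V))
    {D : Finset V → PMF (Finset V)} (hD : ∀ S, ∀ A ∈ (D S).support, S ⊆ A)
    {F : Finset V → V → ℝ} (hF : ∀ S, ∀ v ∈ S, F S v = 1) :
    ∫ c, lossEst r F c ∂(incompleteCascade r P D).toMeasure = sqErr P D F := by
  rw [incompleteCascade, integral_bind, sqErr]
  refine integral_congr_support _ fun c hc => ?_
  simp only [cascade, PMF.mem_support_bind_iff, PMF.support_map] at hc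
  obtain ⟨S, -, A, hA, rfl⟩ := hc
  exact integral_lossEst_observe r hr F (hD S A hA) (hF S)

lemma one_div_le_sq (r : unitInterval) (hr : 0 < r) :
    1 / (r : ℝ) ≤ 1 / (r : ℝ) ^ 2 ∧ 1 ≤ 1 / (r : ℝ) ^ 2 := by
  have h0 : (0 : ℝ) < r := unitInterval.coe_pos.2 hr
  have h1 : (r : ℝ) ≤ 1 := r.2.2
  constructor
  · exact one_div_le_one_div_of_le (by positivity) (by nlinarith)
  · exact (one_le_div (by positivity)).2 (by nlinarith)

/-- Each summand of the difference factors as `(F - G)(F + G - 2/r)` or `(F - G)(F + G)`. The second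
factor is bounded through `1/r²` rather than `1/r`, so that the average over the nodes is `rbar r`.
-/
lemma abs_lossEst_sub_le (r : V → unitInterval) (hr : ∀ v, 0 < r v) {F G : Finset V → V → ℝ}
    (hF : ∀ S v, F S v ∈ Set.Icc (0 : ℝ) 1) (hG : ∀ S v, G S v ∈ Set.Icc (0 : ℝ) 1) {τ : ℝ}
    (h : ∀ S v, |F S v - G S v| ≤ τ) (c : Finset V × Finset V) :
    |lossEst r F c - lossEst r G c| ≤ 4 * rbar r * τ := by
  rw [lossEst, lossEst, ← mul_sub, ← Finset.sum_sub_distrib, abs_mul, abs_of_nonneg (by positivity),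
    rbar, mul_left_comm, mul_assoc]
  refine mul_le_mul_of_nonneg_left ?_ (by positivity)
  rw [Finset.mul_sum, Finset.sum_mul]
  refine (Finset.abs_sum_le_sum_abs _ _).trans (Finset.sum_le_sum fun v _ => ?_)
  obtain ⟨h1, h2⟩ := one_div_le_sq (r v) (hr v)
  have h0 : (0 : ℝ) ≤ 1 / (r v : ℝ) := one_div_nonneg.2 (r v).2.1
  have hτ : 0 ≤ τ := (abs_nonneg _).trans (h c.1 v)
  obtain ⟨hF0, hF1⟩ := hF c.1 v
  obtain ⟨hG0, hG1⟩ := hG c.1 v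
  split_ifs with hS hA
  · rw [sub_zero, abs_zero]
    positivity
  · have : (1 / (r v : ℝ)) * (1 - 2 * F c.1 v) + F c.1 v ^ 2
        - ((1 / (r v : ℝ)) * (1 - 2 * G c.1 v) + G c.1 v ^ 2)
        = (F c.1 v - G c.1 v) * (F c.1 v + G c.1 v - 2 * (1 / (r v : ℝ))) := by ring
    rw [this, abs_mul]
    calc _ ≤ τ * (4 * (1 / (r v : ℝ) ^ 2)) := by
          refine mul_le_mul (h _ _) ?_ (abs_nonneg _) hτ
          rw [abs_le]; constructor <;> linarith
      _ = _ := by ring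
  · have : (0 : ℝ) * (1 - 2 * F c.1 v) + F c.1 v ^ 2 - (0 * (1 - 2 * G c.1 v) + G c.1 v ^ 2)
        = (F c.1 v - G c.1 v) * (F c.1 v + G c.1 v) := by ring
    rw [this, abs_mul]
    calc _ ≤ τ * (4 * (1 / (r v : ℝ) ^ 2)) := by
          refine mul_le_mul (h _ _) ?_ (abs_nonneg _) hτ
          rw [abs_le]; constructor <;> linarith
      _ = _ := by ring

lemma abs_lossEst_le (r : V → unitInterval) (hr : ∀ v, 0 < r v) {F : Finset V → V → ℝ}
    (hF : ∀ S v, F S v ∈ Set.Icc (0 : ℝ) 1) (c : Finset V × Finset V) :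
    |lossEst r F c| ≤ 2 * rbar r := by
  rw [lossEst, abs_mul, abs_of_nonneg (by positivity), rbar, mul_left_comm]
  refine mul_le_mul_of_nonneg_left ?_ (by positivity)
  rw [Finset.mul_sum]
  refine (Finset.abs_sum_le_sum_abs _ _).trans (Finset.sum_le_sum fun v _ => ?_)
  obtain ⟨h1, h2⟩ := one_div_le_sq (r v) (hr v)
  have h0 : (0 : ℝ) ≤ 1 / (r v : ℝ) := one_div_nonneg.2 (r v).2.1
  obtain ⟨hF0, hF1⟩ := hF c.1 v
  split_ifs with hS hA
  · rw [abs_zero]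
    positivity
  · have : (0 : ℝ) ≤ F c.1 v ^ 2 ∧ F c.1 v ^ 2 ≤ 1 := ⟨by positivity, by nlinarith⟩
    rw [abs_le]
    constructor <;> nlinarith
  · have : (0 : ℝ) ≤ F c.1 v ^ 2 ∧ F c.1 v ^ 2 ≤ 1 := ⟨by positivity, by nlinarith⟩
    rw [abs_le]
    constructor <;> linarith

lemma one_le_rbar [Nonempty V] (r : V → unitInterval) (hr : ∀ v, 0 < r v) : 1 ≤ rbar r := by
  have hn : (0 : ℝ) < Fintype.card V := by exact_mod_cast Fintype.card_pos
  rw [rbar, one_div, inv_mul_eq_div, le_div_iff₀ hn, one_mul]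
  calc (Fintype.card V : ℝ) = ∑ _v : V, (1 : ℝ) := by simp
    _ ≤ _ := Finset.sum_le_sum fun v _ => (one_div_le_sq (r v) (hr v)).2

/-! ## Learnability of classes with Lipschitz parametrization -/

/-- The numerical end of the argument: number of cells times the Hoeffding tail at deviation `ε/2`
for variables bounded by `4ρ`. The bound `4 ≤ M * ε` absorbs the additive slack `1` of the
approximate minimizer. -/
lemma card_cells_mul_exp_le {n m : ℕ} (hn : 1 ≤ n) (hm : 1 ≤ m) {ρ ε δ M : ℝ} (hρ : 1 ≤ ρ)
    (hε : ε ∈ Set.Ioo (0 : ℝ) 1) (hδ : δ ∈ Set.Ioo (0 : ℝ) 1)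
    (hM : 1000 * (ρ ^ 2 * (n : ℝ) ^ 3 * m / ε ^ 2) * (1 + Real.log (n * m * ρ / (ε * δ))) ^ 1 ≤ M) :
    4 ≤ M * ε ∧ ((⌈32 * ρ * 2 ^ n * m / ε⌉₊ + 1 : ℕ) : ℝ) ^ m *
      Real.exp (-(M * (ε / 2) ^ 2 / (2 * (4 * ρ) ^ 2))) ≤ δ := by
  obtain ⟨hε0, hε1⟩ := hε
  obtain ⟨hδ0, hδ1⟩ := hδ
  have hn' : (1 : ℝ) ≤ n := by exact_mod_cast hn
  have hm' : (1 : ℝ) ≤ m := by exact_mod_cast hm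
  set l := Real.log (ρ * m / ε) with hl
  set L := 1 + Real.log (n * m * ρ / (ε * δ)) with hL
  have hq : 1 ≤ ρ * m / ε := (one_le_div hε0).2 (by nlinarith)
  have hq0 : 0 < ρ * m / ε := by positivity
  have hl0 : 0 ≤ l := Real.log_nonneg hq
  have hlogδ : Real.log δ ≤ 0 := Real.log_nonpos hδ0.le hδ1.le
  have hLeq : L = 1 + Real.log n + l - Real.log δ := by
    have : (n : ℝ) * m * ρ / (ε * δ) = n * (ρ * m / ε) / δ := by field_simp
    rw [hL, this, Real.log_div (by positivity) hδ0.ne', Real.log_mul (by positivity) hq0.ne']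
    ring
  have hlogn : 0 ≤ Real.log n := Real.log_nonneg hn'
  have hL1 : 1 ≤ L := by linarith
  have hY : 1000 * (n * m * L) ≤ M * ε ^ 2 / ρ ^ 2 := by
    rw [le_div_iff₀ (by positivity)]
    rw [pow_one, mul_div_assoc', div_mul_eq_mul_div, div_le_iff₀ (by positivity)] at hM
    refine le_trans ?_ hM
    -- A single factor `n` out of `n ^ 3` suffices; it pays for the `2 ^ n` in the number of cells.
    have h3 : (n : ℝ) ≤ n ^ 3 := le_self_pow₀ hn' (by norm_num)
    calc 1000 * (n * m * L) * ρ ^ 2 = 1000 * (ρ ^ 2 * n * m) * L := by ring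
      _ ≤ _ := by gcongr
  have hnm : 1 ≤ (n : ℝ) * m := one_le_mul_of_one_le_of_one_le hn' hm'
  have hnmL : 1 ≤ (n : ℝ) * m * L := one_le_mul_of_one_le_of_one_le hnm hL1
  constructor
  · have h1 : 1000 ≤ M * ε ^ 2 / ρ ^ 2 := by linarith
    rw [le_div_iff₀ (by positivity)] at h1
    have h2 : 1 ≤ ρ ^ 2 := one_le_pow₀ hρ
    have h3 : 4 ≤ M * ε * ε := by nlinarith
    have h4 : 0 ≤ M * ε := by
      by_contra hneg
      nlinarith
    nlinarith
  · have hK : ((⌈32 * ρ * 2 ^ n * m / ε⌉₊ + 1 : ℕ) : ℝ) ≤ Real.exp (5 + n + l) := by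
      have h2n : (1 : ℝ) ≤ 2 ^ n := one_le_pow₀ (by norm_num)
      have hx : 32 * ρ * 2 ^ n * m / ε = 32 * (2 ^ n * (ρ * m / ε)) := by ring
      have h1 : 1 ≤ 2 ^ n * (ρ * m / ε) := one_le_mul_of_one_le_of_one_le h2n hq
      have h2 := Nat.ceil_lt_add_one (show (0 : ℝ) ≤ 32 * ρ * 2 ^ n * m / ε by positivity)
      have h3 : (2 : ℝ) ^ n ≤ Real.exp n := by
        rw [← mul_one (n : ℝ), Real.exp_nat_mul]
        exact pow_le_pow_left₀ (by norm_num) (by linarith [Real.exp_one_gt_d9]) n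
      -- 34 = 32 + 1 + 1: the ceiling and the extra cell cost at most `1` each, and `2 ^ n * (ρ * m
      -- / ε) ≥ 1`.
      have h4 : (34 : ℝ) ≤ Real.exp 5 := by
        have : Real.exp 5 = Real.exp 1 ^ 5 := by rw [← Real.exp_nat_mul]; norm_num
        rw [this]
        calc (34 : ℝ) ≤ 2.7 ^ 5 := by norm_num
          _ ≤ _ := pow_le_pow_left₀ (by norm_num) (by linarith [Real.exp_one_gt_d9]) 5
      rw [Real.exp_add, Real.exp_add, hl, Real.exp_log hq0, mul_assoc (Real.exp 5)]
      push_cast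
      calc _ ≤ 34 * (2 ^ n * (ρ * m / ε)) := by linarith
        _ ≤ _ := by gcongr
    calc _ ≤ Real.exp (5 + n + l) ^ m * Real.exp (-(M * (ε / 2) ^ 2 / (2 * (4 * ρ) ^ 2))) := by
          gcongr
      _ = Real.exp (m * (5 + n + l) - M * ε ^ 2 / ρ ^ 2 / 128) := by
          rw [← Real.exp_nat_mul, ← Real.exp_add]
          congr 1
          field_simp
          ring
      _ ≤ Real.exp (Real.log δ) := by
          refine Real.exp_le_exp.2 ?_
          have e1 : (m : ℝ) * (5 + n + l) - Real.log δ ≤ m * (5 + n + L) + L := by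
            have : (m : ℝ) * l ≤ m * L := by gcongr; linarith
            nlinarith
          have e2 : (m : ℝ) ≤ n * m * L := by
            calc (m : ℝ) = 1 * m * 1 := by ring
              _ ≤ _ := by gcongr
          have e3 : (m : ℝ) * n ≤ n * m * L := by
            calc (m : ℝ) * n = n * m * 1 := by ring
              _ ≤ _ := by gcongr
          have e4 : (m : ℝ) * L ≤ n * m * L := by
            calc (m : ℝ) * L = 1 * m * L := by ring
              _ ≤ _ := by gcongr
          have e5 : L ≤ n * m * L := by
            calc L = 1 * L := by ring
              _ ≤ _ := by gcongr
          nlinarith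
      _ = δ := Real.exp_log hδ0

/-- For an arbitrary `W` the infimum need not be attained. The slack is an absolute constant because
the algorithm does not know `ε`. -/
lemma exists_approx_minimizer {Θ : Type*} {W : Set Θ} (hW : W.Nonempty) {f : Θ → ℝ} {b : ℝ}
    (hb : ∀ θ, b ≤ f θ) : ∃ θ ∈ W, ∀ θ' ∈ W, f θ ≤ f θ' + 1 := by
  have hbdd : BddBelow (f '' W) := ⟨b, by rintro _ ⟨θ, -, rfl⟩; exact hb θ⟩
  obtain ⟨_, ⟨θ, hθ, rfl⟩, hlt⟩ := exists_lt_of_csInf_lt (hW.image f) (lt_add_one (sInf (f '' W)))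
  exact ⟨θ, hθ, fun θ' hθ' =>
    hlt.le.trans (add_le_add_left (csInf_le hbdd ⟨θ', hθ', rfl⟩) 1)⟩

/-- A class of influence functions is learnable by approximate minimization of the empirical
estimate of the squared error if its parameters are vectors in a cube, indexed by the edges, on
which the influence is Lipschitz. -/
theorem properlyPACLearnable_of_lipschitz {Θ : Type u} (D : Θ → Finset V → PMF (Finset V))
    (W : Set Θ) (E : Finset (V × V)) (r : V → unitInterval) (hr : ∀ v, 0 < r v) (q : Θ → E → ℝ)
    (hq : ∀ θ ∈ W, ∀ e, q θ e ∈ Set.Icc (0 : ℝ) 1)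
    (hD : ∀ θ S, ∀ A ∈ (D θ S).support, S ⊆ A)
    (hlip : ∀ θ ∈ W, ∀ θ' ∈ W, ∀ S v, |influence (D θ) S v - influence (D θ') S v|
      ≤ 2 ^ Fintype.card V * ∑ e, |q θ e - q θ' e|) :
    ProperlyPACLearnable D W r (sampleBound E r 1000 1) := by
  classical
  set ℓ : Θ → Finset V × Finset V → ℝ := fun θ => lossEst r (influence (D θ)) with hℓ
  have hmin (M : ℕ) (c : Fin M → Finset V × Finset V) (hW : W.Nonempty) :
      ∃ θ ∈ W, ∀ θ' ∈ W, ∑ i, ℓ θ (c i) ≤ ∑ i, ℓ θ' (c i) + 1 := by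
    refine exists_approx_minimizer hW (b := ∑ _i : Fin M, -(2 * rbar r)) fun θ => ?_
    exact Finset.sum_le_sum fun i _ =>
      (abs_le.1 (abs_lossEst_le r hr (influence_mem_Icc (D θ)) (c i))).1
  choose! est hestW hest using hmin
  refine ⟨fun M c => if hW : W.Nonempty then influence (D (est M c hW)) else 0,
    fun hW M c => ⟨est M c hW, hestW M c hW, by simp [hW]⟩, ?_⟩
  intro ε hε δ hδ θ₀ hθ₀ P M hM
  have hW : W.Nonempty := ⟨θ₀, hθ₀⟩
  simp only [hW, dif_pos]
  -- Without edges the sample bound is `0`, so no data may be available; but then the Lipschitz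
  -- bound makes all influence functions of the class equal.
  rcases E.eq_empty_or_nonempty with rfl | hE
  · have hempty : {c : Fin M → Finset V × Finset V |
        ε ≤ sqErr P (D θ₀) (influence (D (est M c hW))) - sqErr P (D θ₀) (influence (D θ₀))} = ∅ := by
      refine Set.eq_empty_of_forall_notMem fun c hc => ?_
      have heq : influence (D (est M c hW)) = influence (D θ₀) := by
        funext S v
        have h := hlip _ (hestW M c hW) _ hθ₀ S v
        simp only [Finset.univ_eq_empty, Finset.sum_empty, mul_zero] at h
        exact sub_eq_zero.1 (abs_nonpos_iff.1 h)
      rw [Set.mem_ofPred_eq, heq, sub_self] at hc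
      exact hε.1.not_ge hc
    rw [hempty, measureReal_empty]
    exact hδ.1.le
  obtain ⟨e₀, he₀⟩ := hE
  have : Nonempty V := ⟨e₀.1⟩
  have hρ := one_le_rbar r hr
  have hm : 1 ≤ E.card := Finset.card_pos.2 ⟨e₀, he₀⟩
  obtain ⟨hM4, hfinal⟩ := card_cells_mul_exp_le (n := Fintype.card V) (m := E.card)
    Fintype.card_pos hm hρ hε hδ hM
  -- Parameters within `1/K` in each coordinate change the loss estimate by at most `4 r̄ · 2ⁿ m /
  -- K`, which is at most `ε/8` for this `K`.
  set K : ℕ := ⌈32 * rbar r * 2 ^ Fintype.card V * E.card / ε⌉₊ with hKdef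
  have hKpos : (0 : ℝ) < K := by
    have h0 : 0 < 32 * rbar r * 2 ^ Fintype.card V * E.card / ε :=
      div_pos (by positivity) hε.1
    exact h0.trans_le (Nat.le_ceil _)
  -- The floor takes the value `K` when the coordinate is `1`, hence `K + 1` cells; on `W` the
  -- reduction modulo `K + 1` in `Fin.ofNat` has no effect.
  set cell : Θ → E → Fin (K + 1) := fun θ e => Fin.ofNat (K + 1) ⌊K * q θ e⌋₊ with hcell
  have hclose : ∀ θ ∈ W, ∀ θ' ∈ W, cell θ = cell θ' → ∀ c, |ℓ θ c - ℓ θ' c| ≤ ε / 8 := by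
    intro θ hθ θ' hθ' hcc c
    have hfl : ∀ θ ∈ W, ∀ e, ⌊K * q θ e⌋₊ < K + 1 := by
      intro θ hθ e
      refine Nat.lt_succ_of_le (Nat.floor_le_of_le ?_)
      exact mul_le_of_le_one_right hKpos.le (hq θ hθ e).2
    have hcoord : ∀ e, |q θ e - q θ' e| ≤ 1 / K := by
      intro e
      have h1 := congrArg Fin.val (congrFun hcc e)
      simp only [hcell, Fin.val_ofNat, Nat.mod_eq_of_lt (hfl θ hθ e),
        Nat.mod_eq_of_lt (hfl θ' hθ' e)] at h1
      have h2 := Nat.floor_le (mul_nonneg hKpos.le (hq θ hθ e).1)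
      have h3 := Nat.lt_floor_add_one (K * q θ e)
      have h4 := Nat.floor_le (mul_nonneg hKpos.le (hq θ' hθ' e).1)
      have h5 := Nat.lt_floor_add_one (K * q θ' e)
      rw [h1] at h2 h3
      have h6 : |q θ e - q θ' e| * K = |(q θ e - q θ' e) * K| := by
        rw [abs_mul, abs_of_pos hKpos]
      rw [le_div_iff₀ hKpos, h6, abs_le]
      constructor <;> linarith
    have hsum : ∀ S v, |influence (D θ) S v - influence (D θ') S v|
        ≤ 2 ^ Fintype.card V * (E.card * (1 / K)) := by
      intro S v
      refine (hlip θ hθ θ' hθ' S v).trans ?_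
      refine mul_le_mul_of_nonneg_left ?_ (by positivity)
      refine (Finset.sum_le_sum fun e _ => hcoord e).trans_eq ?_
      simp
    refine (abs_lossEst_sub_le r hr (influence_mem_Icc _) (influence_mem_Icc _) hsum c).trans ?_
    have h1 := Nat.le_ceil (32 * rbar r * 2 ^ Fintype.card V * E.card / ε)
    rw [← hKdef, div_le_iff₀ hε.1] at h1
    have : 4 * rbar r * (2 ^ Fintype.card V * (E.card * (1 / (K : ℝ))))
        = 32 * rbar r * 2 ^ Fintype.card V * E.card / K / 8 := by ring
    rw [this]
    gcongr
    rw [div_le_iff₀ hKpos]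
    linarith
  -- Representatives are chosen independently of the sample, so Hoeffding applies to each of them.
  -- Cells that miss `W` receive the dummy `θ₀`.
  have hrep : ∀ f : E → Fin (K + 1), ∃ θ ∈ W, ∀ θ' ∈ W, cell θ' = f → cell θ = f := by
    intro f
    by_cases h : ∃ θ ∈ W, cell θ = f
    · obtain ⟨θ, hθ, hf⟩ := h
      exact ⟨θ, hθ, fun _ _ _ => hf⟩
    · exact ⟨θ₀, hθ₀, fun θ' hθ' hf => absurd ⟨θ', hθ', hf⟩ h⟩
  choose rep hrepW hrep using hrep
  set p := incompleteCascade r P (D θ₀) with hp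
  have hint : ∀ θ, ∫ c, ℓ θ c ∂p.toMeasure = sqErr P (D θ₀) (influence (D θ)) := fun θ =>
    integral_lossEst r hr P (hD θ₀) fun S v hv => influence_eq_one (hD θ) hv
  -- Working with the excess loss over `θ₀` requires only one one-sided tail bound per cell.
  set Z : (E → Fin (K + 1)) → Finset V × Finset V → ℝ := fun f c => ℓ (rep f) c - ℓ θ₀ c with hZ
  have hZint : ∀ f, ∫ c, Z f c ∂p.toMeasure
      = sqErr P (D θ₀) (influence (D (rep f))) - sqErr P (D θ₀) (influence (D θ₀)) := by
    intro f
    rw [hZ, integral_sub .of_finite .of_finite, hint, hint]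
  have hZb : ∀ f c, |Z f c| ≤ 4 * rbar r := by
    intro f c
    refine (abs_sub _ _).trans ?_
    have h1 := abs_lossEst_le r hr (influence_mem_Icc (D (rep f))) c
    have h2 := abs_lossEst_le r hr (influence_mem_Icc (D θ₀)) c
    simp only [hℓ]
    linarith
  -- If the output is bad, the representative of its cell has mean excess at least `7ε/8`, while
  -- near-minimality against `θ₀` keeps its empirical excess sum at most `1 + Mε/8`. The gap is at
  -- least `3Mε/4 - 1 ≥ Mε/2`, as `Mε ≥ 4`.
  have hsub : {c : Fin M → Finset V × Finset V |
      ε ≤ sqErr P (D θ₀) (influence (D (est M c hW))) - sqErr P (D θ₀) (influence (D θ₀))}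
      ⊆ ⋃ f, {c | M * (ε / 2) ≤ ∑ i, (∫ a, Z f a ∂p.toMeasure - Z f (c i))} := by
    intro c hc
    rw [Set.mem_ofPred_eq] at hc
    set θ := est M c hW with hθ
    have hθW : θ ∈ W := hestW M c hW
    have hcl := hclose (rep (cell θ)) (hrepW _) θ hθW (hrep _ θ hθW rfl)
    refine Set.mem_iUnion.2 ⟨cell θ, ?_⟩
    have h1 : ε - ε / 8 ≤ ∫ a, Z (cell θ) a ∂p.toMeasure := by
      have : sqErr P (D θ₀) (influence (D θ)) - ε / 8
          ≤ sqErr P (D θ₀) (influence (D (rep (cell θ)))) := by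
        have h6 : ∫ a, (ℓ θ a - ε / 8) ∂p.toMeasure ≤ ∫ a, ℓ (rep (cell θ)) a ∂p.toMeasure :=
          integral_mono .of_finite .of_finite fun a => by linarith [(abs_le.1 (hcl a)).1]
        rw [integral_sub .of_finite .of_finite, hint, hint] at h6
        simpa using h6
      rw [hZint]
      linarith
    have h2 : ∑ i, Z (cell θ) (c i) ≤ 1 + M * (ε / 8) := by
      have h3 := hest M c hW θ₀ hθ₀
      have h4 : ∑ i, ℓ (rep (cell θ)) (c i) ≤ ∑ i, (ℓ θ (c i) + ε / 8) :=
        Finset.sum_le_sum fun i _ => by linarith [(abs_le.1 (hcl (c i))).2]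
      simp only [hZ, Finset.sum_sub_distrib]
      simp only [Finset.sum_add_distrib, Finset.sum_const, Finset.card_univ, Fintype.card_fin,
        nsmul_eq_mul] at h4
      linarith
    rw [Set.mem_ofPred_eq, Finset.sum_sub_distrib]
    simp only [Finset.sum_const, Finset.card_univ, Fintype.card_fin, nsmul_eq_mul]
    have h5 : (M : ℝ) * (ε - ε / 8) ≤ M * ∫ a, Z (cell θ) a ∂p.toMeasure := by gcongr
    linarith
  calc _ ≤ (trainingLaw r P (D θ₀) M).real
        (⋃ f, {c | M * (ε / 2) ≤ ∑ i, (∫ a, Z f a ∂p.toMeasure - Z f (c i))}) :=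
        measureReal_mono hsub (by unfold trainingLaw; finiteness)
    _ ≤ ∑ f, (trainingLaw r P (D θ₀) M).real
        {c | M * (ε / 2) ≤ ∑ i, (∫ a, Z f a ∂p.toMeasure - Z f (c i))} :=
        measureReal_iUnion_fintype_le _
    _ ≤ ∑ _f : E → Fin (K + 1), Real.exp (-(M * (ε / 2) ^ 2 / (2 * (4 * rbar r) ^ 2))) :=
        Finset.sum_le_sum fun f _ =>
          pi_real_sum_sub_ge_le p (Z f) (hZb f) (half_pos hε.1).le M
    _ ≤ δ := by
        simpa using hfinal

/-! ## Lipschitz continuity of the influence -/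

/-- The coupling inequality: the integrands agree off `B` and differ by at most `1` on it. -/
lemma abs_integral_sub_le_measureReal {Ω α : Type*} [MeasurableSpace Ω] (μ : Measure Ω)
    [IsProbabilityMeasure μ] [Finite α] [MeasurableSpace α] [MeasurableSingletonClass α]
    {X Y : Ω → α} (hX : Measurable X) (hY : Measurable Y) {g : α → ℝ}
    (hg : ∀ a, g a ∈ Set.Icc (0 : ℝ) 1) {B : Set Ω} (hB : MeasurableSet B)
    (h : ∀ ω, ω ∉ B → X ω = Y ω) :
    |∫ ω, g (X ω) ∂μ - ∫ ω, g (Y ω) ∂μ| ≤ μ.real B := by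
  have hgm : Measurable g := measurable_of_finite g
  have hint : ∀ {Z : Ω → α}, Measurable Z → Integrable (fun ω => g (Z ω)) μ := fun hZ =>
    Integrable.of_mem_Icc 0 1 (hgm.comp hZ).aemeasurable (ae_of_all _ fun ω => hg _)
  rw [← integral_sub (hint hX) (hint hY), ← integral_indicator_one hB]
  refine (abs_integral_le_integral_abs).trans (integral_mono ((hint hX).sub (hint hY)).abs
    ((integrable_const (1 : ℝ)).indicator hB) fun ω => ?_)
  by_cases hω : ω ∈ B
  · have h1 := hg (X ω)
    have h2 := hg (Y ω)
    simp only [Set.indicator_of_mem hω, Pi.one_apply]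
    rw [abs_le]
    constructor <;> linarith [h1.1, h1.2, h2.1, h2.2]
  · simp [hω, h ω hω]

/-! ### Uniform thresholds falling between two bounds -/

section Thresholds

variable {ι : Type*} [Fintype ι]

lemma measurableSet_coord_mem_uIoc (i : ι) (a b : ℝ) :
    MeasurableSet {θ : ι → unitInterval | (θ i : ℝ) ∈ Set.uIoc a b} :=
  (measurable_subtype_coe.comp (measurable_pi_apply i)) measurableSet_uIoc

lemma pi_volume_real_coord_mem_uIoc_le (i : ι) (a b : ℝ) :
    (Measure.pi fun _ : ι => (volume : Measure unitInterval)).real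
      {θ | (θ i : ℝ) ∈ Set.uIoc a b} ≤ |a - b| := by
  have h : (Measure.pi fun _ : ι => (volume : Measure unitInterval))
      {θ | (θ i : ℝ) ∈ Set.uIoc a b} = volume {u : unitInterval | (u : ℝ) ∈ Set.uIoc a b} :=
    (measurePreserving_eval (fun _ : ι => (volume : Measure unitInterval)) i).measure_preimage
      (measurable_subtype_coe measurableSet_uIoc).nullMeasurableSet
  rw [measureReal_def, h]
  refine ENNReal.toReal_le_of_le_ofReal (abs_nonneg _) ?_
  rw [unitInterval.volume_apply, abs_sub_comm, ← Real.volume_uIoc]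
  refine measure_mono ?_
  rintro _ ⟨u, hu, rfl⟩
  exact hu

/-- The half-open interval is exactly the set on which the two comparisons disagree. -/
lemma le_iff_le_of_notMem_uIoc {x a b : ℝ} (h : x ∉ Set.uIoc a b) : x ≤ a ↔ x ≤ b := by
  rw [Set.mem_uIoc] at h
  push Not at h
  exact ⟨fun hx => not_lt.1 fun hb => (h.2 hb).not_ge hx,
    fun hx => not_lt.1 fun ha => (h.1 ha).not_ge hx⟩

end Thresholds

/-! ### Independent cascade -/

lemma measurable_decide_le (p : unitInterval) :
    Measurable fun u : unitInterval => decide (u ≤ p) := by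
  refine measurable_to_bool ?_
  have : (fun u : unitInterval => decide (u ≤ p)) ⁻¹' {true} = Set.Iic p := by
    ext u; simp
  rw [this]
  exact measurableSet_Iic

/-- Realizes a coin of any bias by a uniform variable, so that coins of different biases can share
one. -/
lemma map_decide_le_volume (p : unitInterval) :
    (volume : Measure unitInterval).map (fun u => decide (u ≤ p))
      = ProbabilityTheory.bernoulliMeasure true false p := by
  refine Measure.ext_of_singleton fun b => ?_
  rw [Measure.map_apply (measurable_decide_le p) (measurableSet_singleton b)]
  cases b
  · have : (fun u : unitInterval => decide (u ≤ p)) ⁻¹' {false} = Set.Ioi p := by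
      ext u; simp
    rw [this, unitInterval.volume_Ioi, ProbabilityTheory.bernoulliMeasure_apply_of_notMem_of_mem _
      (measurableSet_singleton _) (by simp) (by simp), ENNReal.ofReal]
    congr 1
    ext
    simp [p.2.2]
  · have : (fun u : unitInterval => decide (u ≤ p)) ⁻¹' {true} = Set.Iic p := by
      ext u; simp
    rw [this, unitInterval.volume_Iic, ProbabilityTheory.bernoulliMeasure_apply_of_mem_of_notMem _
      (measurableSet_singleton _) (by simp) (by simp), ENNReal.ofReal]
    congr 1
    ext
    simp [p.2.1]

lemma abs_integral_coinFlips_sub_le {ι : Type u} [Fintype ι] (w w' : ι → unitInterval)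
    {g : (ι → Bool) → ℝ} (hg : ∀ X, g X ∈ Set.Icc (0 : ℝ) 1) :
    |∫ X, g X ∂(coinFlips w).toMeasure - ∫ X, g X ∂(coinFlips w').toMeasure|
      ≤ ∑ i, |(w i : ℝ) - w' i| := by
  have hm (w : ι → unitInterval) : Measurable
      fun (U : ι → unitInterval) i => decide (U i ≤ w i) :=
    measurable_pi_lambda _ fun i => (measurable_decide_le (w i)).comp (measurable_pi_apply i)
  have hcoin (w : ι → unitInterval) : ∫ X, g X ∂(coinFlips w).toMeasure
      = ∫ U : ι → unitInterval, g (fun i => decide (U i ≤ w i))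
        ∂(Measure.pi fun _ => (volume : Measure unitInterval)) := by
    have h := Measure.pi_map_pi (μ := fun _ : ι => (volume : Measure unitInterval))
      (f := fun i u => decide (u ≤ w i)) fun i => (measurable_decide_le (w i)).aemeasurable
    rw [toMeasure_coinFlips]
    simp only [map_decide_le_volume] at h
    rw [← h, MeasureTheory.integral_map (hm w).aemeasurable .of_discrete]
  rw [hcoin, hcoin]
  refine (abs_integral_sub_le_measureReal _ (hm w) (hm w') hg
    (B := ⋃ i, {U | (U i : ℝ) ∈ Set.uIoc (w i : ℝ) (w' i)})
    (MeasurableSet.iUnion fun i => measurableSet_coord_mem_uIoc i _ _) ?_).trans ?_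
  · intro U hU
    funext i
    have hi : (U i : ℝ) ∉ Set.uIoc (w i : ℝ) (w' i) := fun h => hU (Set.mem_iUnion.2 ⟨i, h⟩)
    exact decide_eq_decide.2 (le_iff_le_of_notMem_uIoc hi)
  · exact (measureReal_iUnion_fintype_le _).trans
      (Finset.sum_le_sum fun i _ => pi_volume_real_coord_mem_uIoc_le i _ _)

lemma integral_mem_Icc {α : Type*} [MeasurableSpace α] (μ : Measure α) [IsProbabilityMeasure μ]
    {g : α → ℝ} (hgm : AEMeasurable g μ) (hg : ∀ a, g a ∈ Set.Icc (0 : ℝ) 1) :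
    ∫ a, g a ∂μ ∈ Set.Icc (0 : ℝ) 1 := by
  have hi : Integrable g μ := Integrable.of_mem_Icc 0 1 hgm (ae_of_all _ hg)
  refine ⟨integral_nonneg fun a => (hg a).1, ?_⟩
  calc _ ≤ ∫ _, (1 : ℝ) ∂μ := integral_mono hi (integrable_const _) fun a => (hg a).2
    _ = 1 := by simp

/-- A hybrid argument: replacing `w` by `w'` in one step costs one sum of differences. The test
function must be general, since the induction hypothesis is applied to the conditional expectation
of `g` after one more step. -/
lemma abs_integral_dicState_sub_le (E : Finset (V × V)) (w w' : E → unitInterval) (S : Finset V)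
    (t : ℕ) {g : Finset V × Finset V → ℝ} (hg : ∀ s, g s ∈ Set.Icc (0 : ℝ) 1) :
    |∫ s, g s ∂(dicState E w S t).toMeasure - ∫ s, g s ∂(dicState E w' S t).toMeasure|
      ≤ t * ∑ e, |(w e : ℝ) - w' e| := by
  induction t generalizing g with
  | zero => simp [dicState]
  | succ t ih =>
    simp only [dicState, integral_bind]
    set h : (E → unitInterval) → Finset V × Finset V → ℝ :=
      fun w s => ∫ s', g s' ∂(dicStep E w s).toMeasure with hh
    have h1 := ih (g := h w) fun s => integral_mem_Icc _ .of_discrete hg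
    have h2 : |∫ s, h w s ∂(dicState E w' S t).toMeasure
        - ∫ s, h w' s ∂(dicState E w' S t).toMeasure| ≤ ∑ e, |(w e : ℝ) - w' e| := by
      rw [← integral_sub .of_finite .of_finite]
      refine abs_integral_le_integral_abs.trans ?_
      calc _ ≤ ∫ _, ∑ e, |(w e : ℝ) - w' e| ∂(dicState E w' S t).toMeasure := by
            refine integral_mono .of_finite .of_finite fun s => ?_
            simp only [hh, dicStep, integral_map]
            exact abs_integral_coinFlips_sub_le w w' fun X => hg _
        _ = _ := by simp
    calc _ ≤ _ + _ := abs_sub_le _ (∫ s, h w s ∂(dicState E w' S t).toMeasure) _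
      _ ≤ _ := add_le_add h1 h2
      _ = _ := by push_cast; ring

lemma subset_of_mem_support_dic (E : Finset (V × V)) (w : E → unitInterval) (S A : Finset V)
    (hA : A ∈ (dic E w S).support) : S ⊆ A := by
  have h (t : ℕ) : ∀ s ∈ (dicState E w S t).support, S ⊆ s.1 := by
    induction t with
    | zero => simp [dicState]
    | succ t ih =>
      intro s hs
      simp only [dicState, dicStep, PMF.mem_support_bind_iff, PMF.support_map] at hs
      obtain ⟨s', hs', X, -, rfl⟩ := hs
      exact (ih s' hs').trans Finset.subset_union_left
  rw [dic, PMF.support_map] at hA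
  obtain ⟨s, hs, rfl⟩ := hA
  exact h _ s hs

lemma abs_influence_dic_sub_le (E : Finset (V × V)) (w w' : E → unitInterval) (S : Finset V)
    (v : V) : |influence (dic E w) S v - influence (dic E w') S v|
      ≤ Fintype.card V * ∑ e, |(w e : ℝ) - w' e| := by
  simp only [influence_eq_integral, dic, integral_map]
  refine abs_integral_dicState_sub_le E w w' S _ (g := fun s => if v ∈ s.1 then 1 else 0) fun s => ?_
  split_ifs <;> simp

/-! ### Linear threshold -/

lemma toMeasure_dlt (E : Finset (V × V)) (w : E → ℝ) (S : Finset V) :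
    (dlt E w S).toMeasure = (Measure.pi fun _ : V => (volume : Measure unitInterval)).map
      fun θ => dltActive E w S θ (Fintype.card V) :=
  haveI : IsProbabilityMeasure ((Measure.pi fun _ : V => (volume : Measure unitInterval)).map
      fun θ => dltActive E w S θ (Fintype.card V)) :=
    Measure.isProbabilityMeasure_map (measurable_dltActive E w S _).aemeasurable
  Measure.toPMF_toMeasure _

lemma subset_dltActive (E : Finset (V × V)) (w : E → ℝ) (S : Finset V) (θ : V → unitInterval)
    (t : ℕ) : S ⊆ dltActive E w S θ t := by
  induction t with
  | zero => exact subset_rfl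
  | succ t ih => exact ih.trans Finset.subset_union_left

lemma subset_of_mem_support_dlt (E : Finset (V × V)) (w : E → ℝ) (S A : Finset V)
    (hA : A ∈ (dlt E w S).support) : S ⊆ A := by
  rw [PMF.mem_support_iff, ← PMF.toMeasure_apply_singleton _ _ (measurableSet_singleton A),
    toMeasure_dlt, Measure.map_apply (measurable_dltActive E w S _) (measurableSet_singleton A)] at hA
  obtain ⟨θ, rfl⟩ := nonempty_of_measure_ne_zero hA
  exact subset_dltActive E w S θ _

lemma dltActive_congr (E : Finset (V × V)) {w w' : E → ℝ} (S : Finset V) {θ : V → unitInterval}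
    (h : ∀ A v, (θ v : ℝ) ∉ Set.uIoc (inWeight E w A v) (inWeight E w' A v)) (t : ℕ) :
    dltActive E w S θ t = dltActive E w' S θ t := by
  induction t with
  | zero => rfl
  | succ t ih =>
    simp only [dltActive, ih]
    congr 1
    ext v
    simp [le_iff_le_of_notMem_uIoc (h (dltActive E w' S θ t) v)]

/-- Every edge enters exactly one node, so summing over the nodes counts each edge at most once. -/
lemma sum_abs_inWeight_sub_le (E : Finset (V × V)) (w w' : E → ℝ) (A : Finset V) :
    ∑ v, |inWeight E w A v - inWeight E w' A v| ≤ ∑ e, |w e - w' e| := by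
  rw [← Finset.sum_fiberwise Finset.univ (fun e : E => e.1.2) fun e => |w e - w' e|]
  refine Finset.sum_le_sum fun v _ => ?_
  rw [inWeight, inWeight, ← Finset.sum_sub_distrib]
  refine (Finset.abs_sum_le_sum_abs _ _).trans
    (Finset.sum_le_sum_of_subset_of_nonneg ?_ fun _ _ _ => abs_nonneg _)
  intro e he
  simp only [Finset.mem_filter] at he ⊢
  exact ⟨he.1, he.2.2⟩

/-- The active set that `θ v` is compared against depends itself on `θ`, so the bad event is taken
over all sets `A`; this union bound is the source of `2 ^ Fintype.card V`. -/
lemma abs_influence_dlt_sub_le (E : Finset (V × V)) (w w' : E → ℝ) (S : Finset V) (v : V) :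
    |influence (dlt E w) S v - influence (dlt E w') S v|
      ≤ 2 ^ Fintype.card V * ∑ e, |w e - w' e| := by
  have hmap (w : E → ℝ) : influence (dlt E w) S v
      = ∫ θ, (if v ∈ dltActive E w S θ (Fintype.card V) then 1 else 0)
        ∂(Measure.pi fun _ : V => (volume : Measure unitInterval)) := by
    rw [influence_eq_integral, toMeasure_dlt,
      MeasureTheory.integral_map (measurable_dltActive E w S _).aemeasurable .of_discrete]
  rw [hmap, hmap]
  refine (abs_integral_sub_le_measureReal _ (measurable_dltActive E w S _)
    (measurable_dltActive E w' S _) (g := fun A => if v ∈ A then 1 else 0)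
    (fun A => by split_ifs <;> simp)
    (B := ⋃ A : Finset V, ⋃ v, {θ | (θ v : ℝ) ∈ Set.uIoc (inWeight E w A v) (inWeight E w' A v)})
    (.iUnion fun A => .iUnion fun v => measurableSet_coord_mem_uIoc v _ _) ?_).trans ?_
  · intro θ hθ
    refine dltActive_congr E S (fun A v hv => hθ ?_) _
    exact Set.mem_iUnion.2 ⟨A, Set.mem_iUnion.2 ⟨v, hv⟩⟩
  · calc _ ≤ ∑ A : Finset V, ∑ v, |inWeight E w A v - inWeight E w' A v| :=
          (measureReal_iUnion_fintype_le _).trans (Finset.sum_le_sum fun A _ =>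
            (measureReal_iUnion_fintype_le _).trans
              (Finset.sum_le_sum fun v _ => pi_volume_real_coord_mem_uIoc_le v _ _))
      _ ≤ ∑ _A : Finset V, ∑ e, |w e - w' e| :=
          Finset.sum_le_sum fun A _ => sum_abs_inWeight_sub_le E w w' A
      _ = _ := by simp

end Diffusion

end

theorem theorem4 :
    (∃ (C : ℝ) (k : ℕ), 0 < C ∧ ∀ (V : Type*) [Fintype V] [DecidableEq V] (E : Finset (V × V))
      (r : V → unitInterval), (∀ v, 0 < r v) → ∀ lam : ℝ, 0 < lam → lam < 1 / 2 →
        Diffusion.ProperlyPACLearnable (Diffusion.dic E) (Diffusion.dicParams E lam) r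
          (Diffusion.sampleBound E r C k)) ∧
    (∃ (C : ℝ) (k : ℕ), 0 < C ∧ ∀ (V : Type*) [Fintype V] [DecidableEq V] (E : Finset (V × V))
      (r : V → unitInterval), (∀ v, 0 < r v) → ∀ lam : ℝ, 0 < lam → lam < 1 / 2 →
        Diffusion.ProperlyPACLearnable (Diffusion.dlt E) (Diffusion.dltParams E lam) r
          (Diffusion.sampleBound E r C k)) := by
  refine ⟨⟨1000, 1, by norm_num, fun V _ _ E r hr lam hlam _ => ?_⟩,
    ⟨1000, 1, by norm_num, fun V _ _ E r hr lam hlam _ => ?_⟩⟩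
  · refine Diffusion.properlyPACLearnable_of_lipschitz _ _ E r hr (fun w e => (w e : ℝ))
      (fun w _ e => (w e).2) (Diffusion.subset_of_mem_support_dic E) fun w _ w' _ S v => ?_
    refine (Diffusion.abs_influence_dic_sub_le E w w' S v).trans ?_
    -- The DIC constant `n` is weakened to `2ⁿ` to fit the common criterion.
    gcongr
    exact_mod_cast Nat.lt_two_pow_self.le
  · refine Diffusion.properlyPACLearnable_of_lipschitz _ _ E r hr id
      (fun w hw e => ⟨hlam.le.trans (hw.1 e).1, (hw.1 e).2.trans (by linarith)⟩)
      (Diffusion.subset_of_mem_support_dlt E) fun w _ w' _ S v => ?_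
    exact Diffusion.abs_influence_dlt_sub_le E w w' S v
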